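/- Let $\mathbb K$ be $\mathbb R$ or $\mathbb C$, and let $\ell_1=\ell_1(\mathbb Z_+)$ be the Banach space of absolutely summable sequences in $\mathbb K$ indexed by the non-negative integers, with canonical basis $\{e_n\}_{n\ge 0}$. Let $T:\ell_1\to\ell_1$ be the backward weighted shift with weight sequence $w_n=1/n$, $n\ge 1$, that is, the bounded linear operator with $Te_0=0$ and $Te_n=\frac1n e_{n-1}$ for $n\ge 1$. Then for every $\lambda\in\mathbb K\setminus\{0\}$ the operator $I+\lambda T$ satisfies the Kitai Criterion. Here a bounded linear operator $A$ on a Banach space $X$ satisfies the Kitai Criterion if there exist two dense subsets $E$ and $F$ of $X$ and a map $S:F\to F$ such that $ASy=y$, $S^ky\to 0$ and $A^kx\to 0$ as $k\to\infty$ for all $y\in F$ and $x\in E$. -/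

import Mathlib

open Filter Topology

/-- A bounded linear operator `T` on a normed space `X` satisfies the Kitai Criterion if there are
dense subsets `E`, `F` of `X` and a map `S : F → F` such that `T (S y) = y`, `S ^ k y → 0` and
`T ^ k x → 0` as `k → ∞`, for all `y ∈ F` and `x ∈ E`. -/
def SatisfiesKitaiCriterion {𝕜 X : Type*} [RCLike 𝕜] [NormedAddCommGroup X] [NormedSpace 𝕜 X]
    (T : X →L[𝕜] X) : Prop :=
  ∃ (E F : Set X) (S : F → F), Dense E ∧ Dense F ∧
    (∀ y : F, T (S y : X) = (y : X)) ∧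
    (∀ y : F, Tendsto (fun k : ℕ => ((S^[k] y : F) : X)) atTop (𝓝 0)) ∧
    (∀ x ∈ E, Tendsto (fun k : ℕ => (T ^ k) x) atTop (𝓝 0))

/-- The space `ℓ₁ = ℓ₁(ℤ₊)` of absolutely summable sequences `x₀, x₁, x₂, …` in `𝕜`. -/
abbrev EllOne (𝕜 : Type*) [RCLike 𝕜] : Type _ := lp (fun _ : ℕ => 𝕜) 1

section BackwardShift

variable {𝕜 : Type*} [RCLike 𝕜]

theorem EllOne.summable_norm (x : EllOne 𝕜) : Summable fun n : ℕ => ‖x n‖ := by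
  simpa using (memℓp_gen_iff (by simp)).1 (lp.memℓp x)

theorem EllOne.norm_eq (x : EllOne 𝕜) : ‖x‖ = ∑' n : ℕ, ‖x n‖ := by
  simpa using lp.norm_eq_tsum_rpow (p := 1) (by simp) x

theorem EllOne.summable_shift (w : ℕ → 𝕜) {C : ℝ} (hC : ∀ n, 1 ≤ n → ‖w n‖ ≤ C)
    (x : EllOne 𝕜) : Summable fun n : ℕ => ‖w (n + 1) * x (n + 1)‖ := by
  refine Summable.of_nonneg_of_le (fun _ => norm_nonneg _) (fun n => ?_)
    (((summable_nat_add_iff 1).2 (EllOne.summable_norm x)).mul_left C)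
  rw [norm_mul]
  exact mul_le_mul_of_nonneg_right (hC (n + 1) (by omega)) (norm_nonneg _)

/-- The coordinate form of the backward weighted shift on `ℓ₁`, as a linear map:
`(T x)ₙ = wₙ₊₁ xₙ₊₁`. The value `w 0` is not used. -/
def backwardShiftLinear (w : ℕ → 𝕜) (hw : ∃ C : ℝ, ∀ n, 1 ≤ n → ‖w n‖ ≤ C) :
    EllOne 𝕜 →ₗ[𝕜] EllOne 𝕜 where
  toFun x := ⟨fun n => w (n + 1) * x (n + 1), by
    obtain ⟨C, hC⟩ := hw
    refine (memℓp_gen_iff (by simp)).2 ?_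
    simpa using EllOne.summable_shift w hC x⟩
  map_add' x y := by
    ext n
    exact mul_add _ _ _
  map_smul' c x := by
    ext n
    exact mul_left_comm _ _ _

/-- The backward weighted shift on `ℓ₁` with the bounded weight sequence `w₁, w₂, …`:
the bounded operator `T` with `T e₀ = 0` and `T eₙ = wₙ eₙ₋₁` for `n ≥ 1`
(see `backwardShift_single_zero` and `backwardShift_single_succ`). -/
noncomputable def backwardShift (w : ℕ → 𝕜) (hw : ∃ C : ℝ, ∀ n, 1 ≤ n → ‖w n‖ ≤ C) :
    EllOne 𝕜 →L[𝕜] EllOne 𝕜 :=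
  (backwardShiftLinear w hw).mkContinuousOfExistsBound (by
    obtain ⟨C, hC⟩ := hw
    refine ⟨C, fun x => ?_⟩
    have hC0 : 0 ≤ C := (norm_nonneg _).trans (hC 1 le_rfl)
    rw [EllOne.norm_eq, EllOne.norm_eq]
    have h1 : ∑' n : ℕ, ‖w (n + 1) * x (n + 1)‖ ≤ ∑' n : ℕ, C * ‖x (n + 1)‖ := by
      refine (EllOne.summable_shift w hC x).tsum_le_tsum (fun n => ?_)
        (((summable_nat_add_iff 1).2 (EllOne.summable_norm x)).mul_left C)
      rw [norm_mul]
      exact mul_le_mul_of_nonneg_right (hC (n + 1) (by omega)) (norm_nonneg _)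
    refine h1.trans ?_
    rw [tsum_mul_left, (EllOne.summable_norm x).tsum_eq_zero_add]
    exact mul_le_mul_of_nonneg_left (le_add_of_nonneg_left (norm_nonneg _)) hC0)

theorem backwardShift_apply (w : ℕ → 𝕜) (hw : ∃ C : ℝ, ∀ n, 1 ≤ n → ‖w n‖ ≤ C)
    (x : EllOne 𝕜) (n : ℕ) : backwardShift w hw x n = w (n + 1) * x (n + 1) := rfl

theorem backwardShift_single_zero (w : ℕ → 𝕜) (hw : ∃ C : ℝ, ∀ n, 1 ≤ n → ‖w n‖ ≤ C) :
    backwardShift w hw (lp.single 1 0 (1 : 𝕜)) = 0 := by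
  ext n
  simp [backwardShift_apply]

theorem backwardShift_single_succ (w : ℕ → 𝕜) (hw : ∃ C : ℝ, ∀ n, 1 ≤ n → ‖w n‖ ≤ C) (n : ℕ) :
    backwardShift w hw (lp.single 1 (n + 1) (1 : 𝕜)) = w (n + 1) • lp.single 1 n (1 : 𝕜) := by
  ext m
  rw [backwardShift_apply]
  by_cases h : m = n
  · subst h
    simp
  · simp [h]

end BackwardShift

theorem one_div_weights_bounded (𝕜 : Type*) [RCLike 𝕜] :
    ∃ C : ℝ, ∀ n : ℕ, 1 ≤ n → ‖(1 / (n : 𝕜))‖ ≤ C := by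
  refine ⟨1, fun n hn => ?_⟩
  rw [norm_div, norm_one, RCLike.norm_natCast]
  exact (div_le_one (by exact_mod_cast hn)).2 (by exact_mod_cast hn)

/-! Let `H` be the backward shift with weights `1 / n` and `B` the unweighted one. For
`t = lam • H` and `b = lam • B` the commutator relation `⁅t, b⁆ = t ^ 2` gives
`exp (b + t) = (1 + t) * exp b`. Hence `1 + t` has the right inverse `exp b * exp (-(b + t))`, and
this right inverse is conjugate to `1 - t`, so it is enough that for every `lam ≠ 0` the vectors
with vanishing orbit under `1 - lam • H` are dense.

The orbit of the vector with entries `s ^ n / (n + 1)` is explicit: up to scalar factors its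
entries are Laguerre polynomials evaluated at `lam * s`. If `u = lam * s` is positive, an energy
estimate for the Laguerre equation bounds the `k`-th vector of the orbit by a multiple of
`1 / √((k + 1) * u)`, so the orbit vanishes. Such points `s` accumulate at `0` and the vector is a
power series in `s`, so by the identity theorem its coefficients `e_n / (n + 1)` lie in the closed
span of these vectors. -/

section Commutator

open NormedSpace

theorem add_pow_succ_of_lie_eq_sq {R : Type*} [Ring R] {t b : R} (h : ⁅t, b⁆ = t ^ 2) (n : ℕ) :
    (b + t) ^ (n + 1) = b ^ (n + 1) + (n + 1) • (t * b ^ n) := by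
  have hmul : (b + t) * t = t * b := by
    rw [add_mul, ← sq, ← h, Ring.lie_def, add_sub_cancel]
  induction n with
  | zero => simp
  | succ n ih =>
    calc (b + t) ^ (n + 2) = (b + t) * b ^ (n + 1) + (n + 1) • ((b + t) * t * b ^ n) := by
          rw [pow_succ', ih, mul_add, mul_smul_comm, mul_assoc]
      _ = b ^ (n + 2) + (t * b ^ (n + 1) + (n + 1) • (t * b ^ (n + 1))) := by
          rw [hmul, add_mul, mul_assoc t, ← pow_succ', ← pow_succ', add_assoc]
      _ = b ^ (n + 2) + (n + 2) • (t * b ^ (n + 1)) := by rw [← succ_nsmul']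

variable {A : Type*} [NormedRing A] [NormedAlgebra ℚ A] [CompleteSpace A] {t b : A}

theorem exp_add_of_lie_eq_sq (h : ⁅t, b⁆ = t ^ 2) : exp (b + t) = (1 + t) * exp b := by
  have hb := exp_series_hasSum_exp' (𝕂 := ℚ) b
  have hsucc (n : ℕ) : ((n + 1).factorial : ℚ)⁻¹ • (b + t) ^ (n + 1) =
      ((n + 1).factorial : ℚ)⁻¹ • b ^ (n + 1) + t * ((n.factorial : ℚ)⁻¹ • b ^ n) := by
    rw [add_pow_succ_of_lie_eq_sq h, smul_add, ← Nat.cast_smul_eq_nsmul ℚ, smul_smul,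
      Nat.factorial_succ, Nat.cast_mul, mul_inv_rev, mul_assoc,
      inv_mul_cancel₀ (Nat.cast_ne_zero.2 n.succ_ne_zero), mul_one, mul_smul_comm]
  have htail : HasSum (fun n : ℕ => ((n + 1).factorial : ℚ)⁻¹ • (b + t) ^ (n + 1))
      (exp b - 1 + t * exp b) := by
    simp only [hsucc]
    refine HasSum.add ?_ (hb.mul_left t)
    simpa using (hasSum_nat_add_iff' 1).2 hb
  have htotal := (exp_series_hasSum_exp' (𝕂 := ℚ) (b + t)).unique
    ((hasSum_nat_add_iff 1).1 htail)
  rw [htotal, Finset.sum_range_one, Nat.factorial_zero, Nat.cast_one, inv_one, pow_zero, one_smul]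
  noncomm_ring

theorem semiconjBy_exp_of_lie_eq_sq (h : ⁅t, b⁆ = t ^ 2) :
    SemiconjBy (exp b) (1 - t) (exp b * exp (-(b + t))) := by
  have hneg : exp (-(b + t)) = (1 - t) * exp (-b) := by
    rw [neg_add, sub_eq_add_neg]
    refine exp_add_of_lie_eq_sq ?_
    rw [Ring.lie_def, neg_mul_neg, neg_mul_neg, neg_sq, ← Ring.lie_def, h]
  have hinv : exp (-b) * exp b = 1 := by
    rw [← exp_add_of_commute (Commute.refl b).neg_left, neg_add_cancel, exp_zero]
  rw [SemiconjBy, hneg, mul_assoc, mul_assoc, hinv, mul_one]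

theorem one_add_mul_exp_mul_exp_neg_of_lie_eq_sq (h : ⁅t, b⁆ = t ^ 2) :
    (1 + t) * (exp b * exp (-(b + t))) = 1 := by
  rw [← mul_assoc, ← exp_add_of_lie_eq_sq h,
    ← exp_add_of_commute (Commute.refl (b + t)).neg_right, add_neg_cancel, exp_zero]

end Commutator

section VanishingOrbits

variable {R X : Type*} [Semiring R] [TopologicalSpace X] [AddCommMonoid X] [Module R X]
  [ContinuousAdd X] [ContinuousConstSMul R X]

/-- The subspace of vectors whose orbit under `A` tends to zero. In the Kitai Criterion for a right
invertible operator it supplies both dense sets, from the operator and from its right inverse. -/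
def vanishingOrbits (A : X →L[R] X) : Submodule R X where
  carrier := {x | Tendsto (fun k : ℕ => (A ^ k) x) atTop (𝓝 0)}
  zero_mem' := by simp only [Set.mem_ofPred_eq, map_zero, tendsto_const_nhds]
  add_mem' {x y} hx hy := by simpa only [Set.mem_ofPred_eq, map_add, add_zero] using hx.add hy
  smul_mem' c x hx := by simpa only [Set.mem_ofPred_eq, map_smul, smul_zero] using hx.const_smul c

theorem mem_vanishingOrbits {A : X →L[R] X} {x : X} :
    x ∈ vanishingOrbits A ↔ Tendsto (fun k : ℕ => (A ^ k) x) atTop (𝓝 0) :=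
  Iff.rfl

theorem map_mem_vanishingOrbits_of_semiconjBy {M A B : X →L[R] X} (h : SemiconjBy M A B) {x : X}
    (hx : x ∈ vanishingOrbits A) : M x ∈ vanishingOrbits B := by
  have hMA : Tendsto (fun k : ℕ => M ((A ^ k) x)) atTop (𝓝 0) := by
    simpa only [map_zero, Function.comp_def] using (M.continuous.tendsto 0).comp hx
  exact hMA.congr fun k => DFunLike.congr_fun (h.pow_right k) x

theorem dense_vanishingOrbits_of_semiconjBy {M A B : X →L[R] X} (h : SemiconjBy M A B)
    (hM : DenseRange M) (hA : Dense (vanishingOrbits A : Set X)) :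
    Dense (vanishingOrbits B : Set X) :=
  (hM.dense_image M.continuous hA).mono
    (Set.image_subset_iff.2 fun _ => map_mem_vanishingOrbits_of_semiconjBy h)

end VanishingOrbits

section Kitai

variable {𝕜 X : Type*} [RCLike 𝕜] [NormedAddCommGroup X] [NormedSpace 𝕜 X]

theorem SatisfiesKitaiCriterion.of_mul_eq_one {T R : X →L[𝕜] X} (h : T * R = 1)
    (hT : Dense (vanishingOrbits T : Set X)) (hR : Dense (vanishingOrbits R : Set X)) :
    SatisfiesKitaiCriterion T := by
  have hmaps : Set.MapsTo R (vanishingOrbits R) (vanishingOrbits R) := fun _ =>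
    map_mem_vanishingOrbits_of_semiconjBy rfl
  refine ⟨vanishingOrbits T, vanishingOrbits R, hmaps.restrict, hT, hR,
    fun y => DFunLike.congr_fun h (y : X), fun y => ?_, fun x hx => hx⟩
  simpa only [hmaps.iterate_restrict, Set.MapsTo.val_restrict_apply, FunLike.coe_pow_eq_iterate]
    using mem_vanishingOrbits.1 y.2

theorem SatisfiesKitaiCriterion.one_add_of_lie_eq_sq [CompleteSpace X] {t b : X →L[𝕜] X}
    (h : ⁅t, b⁆ = t ^ 2) (hadd : Dense (vanishingOrbits (1 + t) : Set X))
    (hsub : Dense (vanishingOrbits (1 - t) : Set X)) : SatisfiesKitaiCriterion (1 + t) := by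
  let : NormedAlgebra ℚ (X →L[𝕜] X) := NormedAlgebra.restrictScalars ℚ 𝕜 _
  have hinv : NormedSpace.exp b * NormedSpace.exp (-b) = 1 := by
    rw [← NormedSpace.exp_add_of_commute (Commute.refl b).neg_right, add_neg_cancel,
      NormedSpace.exp_zero]
  have hsurj : Function.Surjective (NormedSpace.exp b : X →L[𝕜] X) := fun x =>
    ⟨NormedSpace.exp (-b) x, DFunLike.congr_fun hinv x⟩
  exact .of_mul_eq_one (one_add_mul_exp_mul_exp_neg_of_lie_eq_sq h) hadd
    (dense_vanishingOrbits_of_semiconjBy (semiconjBy_exp_of_lie_eq_sq h) hsurj.denseRange hsub)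

end Kitai

section Laguerre

open Polynomial

variable (K : Type*) [Field K]

/-- The multiple `k! / (k + n)! * L_k^{(n)}` of the generalized Laguerre polynomial with parameter
`n`, that is `∑ j, (k choose j) * (-X) ^ j / (n + j)!`, defined by its Pascal recursion. -/
noncomputable def scaledLaguerre : ℕ → ℕ → K[X]
  | 0, n => C (n.factorial : K)⁻¹
  | k + 1, n => scaledLaguerre k n - X * scaledLaguerre k (n + 1)

theorem scaledLaguerre_zero (n : ℕ) : scaledLaguerre K 0 n = C (n.factorial : K)⁻¹ := rfl

theorem scaledLaguerre_succ (k n : ℕ) :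
    scaledLaguerre K (k + 1) n = scaledLaguerre K k n - X * scaledLaguerre K k (n + 1) := rfl

theorem map_scaledLaguerre {L : Type*} [Field L] (f : K →+* L) (k n : ℕ) :
    (scaledLaguerre K k n).map f = scaledLaguerre L k n := by
  induction k generalizing n with
  | zero => simp [scaledLaguerre_zero]
  | succ k ih => simp [scaledLaguerre_succ, ih]

theorem eval_zero_scaledLaguerre (k n : ℕ) :
    (scaledLaguerre K k n).eval 0 = (n.factorial : K)⁻¹ := by
  induction k generalizing n with
  | zero => simp [scaledLaguerre_zero]
  | succ k ih => simp [scaledLaguerre_succ, ih]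

variable [CharZero K]

theorem succ_mul_inv_factorial_succ (n : ℕ) :
    ((n : K) + 1) * ((n + 1).factorial : K)⁻¹ = (n.factorial : K)⁻¹ := by
  rw [Nat.factorial_succ, Nat.cast_mul, mul_inv, Nat.cast_succ,
    mul_inv_cancel_left₀ (Nat.cast_add_one_ne_zero n)]

theorem X_mul_derivative_scaledLaguerre_succ (k n : ℕ) :
    X * derivative (scaledLaguerre K k (n + 1)) =
      scaledLaguerre K k n - (n + 1 : K[X]) * scaledLaguerre K k (n + 1) := by
  induction k generalizing n with
  | zero =>
    rw [scaledLaguerre_zero, scaledLaguerre_zero, derivative_C, mul_zero, eq_comm, sub_eq_zero,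
      ← succ_mul_inv_factorial_succ]
    simp
  | succ k ih =>
    have ih' := ih (n + 1)
    push_cast at ih'
    rw [scaledLaguerre_succ, scaledLaguerre_succ, derivative_sub, derivative_mul, derivative_X]
    linear_combination ih n - X * ih'

theorem derivative_scaledLaguerre (k n : ℕ) :
    derivative (scaledLaguerre K k n) =
      scaledLaguerre K k n - (k + n + 1 : K[X]) * scaledLaguerre K k (n + 1) := by
  induction k generalizing n with
  | zero =>
    rw [scaledLaguerre_zero, scaledLaguerre_zero, derivative_C, eq_comm, sub_eq_zero,
      ← succ_mul_inv_factorial_succ]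
    simp
  | succ k ih =>
    have ih' := ih (n + 1)
    push_cast at ih' ⊢
    rw [scaledLaguerre_succ, scaledLaguerre_succ, derivative_sub, derivative_mul, derivative_X]
    linear_combination ih n - X * ih'

/-- The Lyapunov function of the first-order system satisfied by `scaledLaguerre ℝ k n` and
`scaledLaguerre ℝ k (n + 1)`. -/
noncomputable def laguerreEnergy (k n : ℕ) : ℝ[X] :=
  (k + n + 1 : ℝ[X]) * X * scaledLaguerre ℝ k (n + 1) ^ 2 + scaledLaguerre ℝ k n ^ 2

theorem derivative_laguerreEnergy (k n : ℕ) :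
    derivative (laguerreEnergy k n) =
      2 * scaledLaguerre ℝ k n ^ 2 -
        (2 * n + 1 : ℝ[X]) * (k + n + 1) * scaledLaguerre ℝ k (n + 1) ^ 2 := by
  simp only [laguerreEnergy, derivative_add, derivative_mul, derivative_pow, derivative_X,
    derivative_natCast, derivative_one, Nat.cast_ofNat, map_ofNat, Nat.add_one_sub_one, pow_one]
  linear_combination
    2 * (k + n + 1 : ℝ[X]) * scaledLaguerre ℝ k (n + 1) *
        X_mul_derivative_scaledLaguerre_succ ℝ k n +
      2 * scaledLaguerre ℝ k n * derivative_scaledLaguerre ℝ k n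

theorem eval_derivative_laguerreEnergy_le (k n : ℕ) {u : ℝ} (hu : 0 ≤ u) :
    (derivative (laguerreEnergy k n)).eval u ≤ 2 * (laguerreEnergy k n).eval u := by
  have hterm : 0 ≤ ((k : ℝ) + n + 1) * (2 * n + 1 + 2 * u) *
      (scaledLaguerre ℝ k (n + 1)).eval u ^ 2 := by positivity
  rw [derivative_laguerreEnergy, laguerreEnergy]
  simp only [eval_add, eval_sub, eval_mul, eval_pow, eval_X, eval_natCast, eval_one, eval_ofNat]
  linarith

theorem eval_laguerreEnergy_le (k n : ℕ) {u : ℝ} (hu : 0 ≤ u) :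
    (laguerreEnergy k n).eval u ≤ (n.factorial : ℝ)⁻¹ ^ 2 * Real.exp (2 * u) := by
  have hzero : (laguerreEnergy k n).eval 0 = (n.factorial : ℝ)⁻¹ ^ 2 := by
    simp [laguerreEnergy, eval_zero_scaledLaguerre]
  have hgronwall := le_gronwallBound_of_liminf_deriv_right_le (K := 2) (ε := 0)
    (laguerreEnergy k n).continuous.continuousOn
    (fun v _ _ => ((laguerreEnergy k n).hasDerivAt v).hasDerivWithinAt.liminf_right_slope_le)
    hzero.le (fun v hv => (eval_derivative_laguerreEnergy_le k n hv.1).trans_eq (add_zero _).symm)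
    u ⟨hu, le_rfl⟩
  rwa [gronwallBound_ε0, sub_zero] at hgronwall

theorem abs_eval_scaledLaguerre_succ_le (k n : ℕ) {u : ℝ} (hu : 0 < u) :
    |(scaledLaguerre ℝ k (n + 1)).eval u| ≤
      (n.factorial : ℝ)⁻¹ * (Real.exp u / √((k + 1) * u)) := by
  refine abs_le_of_sq_le_sq ?_ (by positivity)
  have henergy : ((k : ℝ) + 1) * u * (scaledLaguerre ℝ k (n + 1)).eval u ^ 2 ≤
      (laguerreEnergy k n).eval u := by
    have hrest : 0 ≤ (n : ℝ) * u * (scaledLaguerre ℝ k (n + 1)).eval u ^ 2 +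
      (scaledLaguerre ℝ k n).eval u ^ 2 := by positivity
    simp only [laguerreEnergy, eval_add, eval_mul, eval_pow, eval_X, eval_natCast, eval_one]
    linarith
  rw [mul_pow, div_pow, Real.sq_sqrt (by positivity), ← Real.exp_nat_mul, ← mul_div_assoc,
    le_div_iff₀ (by positivity), mul_comm]
  exact_mod_cast henergy.trans (eval_laguerreEnergy_le k n hu.le)

theorem norm_eval_ofReal_scaledLaguerre_succ_le {𝕜 : Type*} [RCLike 𝕜] (k n : ℕ) {u : ℝ}
    (hu : 0 < u) :
    ‖(scaledLaguerre 𝕜 k (n + 1)).eval (u : 𝕜)‖ ≤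
      (n.factorial : ℝ)⁻¹ * (Real.exp u / √((k + 1) * u)) := by
  rw [← map_scaledLaguerre ℝ (algebraMap ℝ 𝕜), ← RCLike.algebraMap_eq_ofReal,
    eval_map_algebraMap, aeval_algebraMap_apply, norm_algebraMap', coe_aeval_eq_eval,
    Real.norm_eq_abs]
  exact abs_eval_scaledLaguerre_succ_le k n hu

end Laguerre

section PowerSeries

theorem eq_zero_of_hasSum_of_frequently_eq_zero {𝕜 E : Type*} [NontriviallyNormedField 𝕜]
    [NormedAddCommGroup E] [NormedSpace 𝕜 E] {v : ℕ → E} {f : 𝕜 → E}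
    (hf : ∀ᶠ z in 𝓝 0, HasSum (fun n => z ^ n • v n) (f z)) (hzero : ∃ᶠ z in 𝓝[≠] 0, f z = 0)
    (n : ℕ) : v n = 0 := by
  let p : FormalMultilinearSeries 𝕜 𝕜 E := fun n =>
    ContinuousMultilinearMap.mkPiRing 𝕜 (Fin n) (v n)
  have hcoeff (n : ℕ) : p.coeff n = v n := by simp [p, FormalMultilinearSeries.coeff]
  have hp : HasFPowerSeriesAt f p 0 :=
    hasFPowerSeriesAt_iff.2 (by simpa only [hcoeff, zero_add] using hf)
  rw [← hcoeff, hp.locally_zero_iff.1 (hp.analyticAt.frequently_zero_iff_eventually_zero.1 hzero)]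
  rfl

theorem mem_of_hasSum_of_frequently_mem {𝕜 E : Type*} [NontriviallyNormedField 𝕜]
    [SeminormedAddCommGroup E] [NormedSpace 𝕜 E] {v : ℕ → E} {f : 𝕜 → E} {G : Submodule 𝕜 E}
    (hG : IsClosed (G : Set E)) (hf : ∀ᶠ z in 𝓝 0, HasSum (fun n => z ^ n • v n) (f z))
    (hmem : ∃ᶠ z in 𝓝[≠] 0, f z ∈ G) (n : ℕ) : v n ∈ G := by
  rw [← Submodule.Quotient.mk_eq_zero]
  refine eq_zero_of_hasSum_of_frequently_eq_zero (v := fun n => G.mkQ (v n))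
    (f := fun z => G.mkQ (f z)) (hf.mono fun z hz => ?_) ?_ n
  · exact hz.mapL G.mkQL
  · simpa using hmem

theorem lp_eq_top_of_isClosed_of_single_mem {𝕜 ι : Type*} [NormedField 𝕜] [DecidableEq ι]
    {p : ENNReal} [Fact (1 ≤ p)] (hp : p ≠ ⊤) {G : Submodule 𝕜 (lp (fun _ : ι => 𝕜) p)}
    (hG : IsClosed (G : Set (lp (fun _ : ι => 𝕜) p)))
    (hsingle : ∀ i, lp.single p i (1 : 𝕜) ∈ G) : G = ⊤ := by
  refine eq_top_iff.2 fun x _ => ?_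
  refine hG.mem_of_tendsto (lp.hasSum_single hp x)
    (Eventually.of_forall fun s => G.sum_mem fun i _ => ?_)
  simpa only [← lp.single_smul, smul_eq_mul, mul_one] using G.smul_mem (x i) (hsingle i)

end PowerSeries

section HarmonicShift

variable {𝕜 : Type*} [RCLike 𝕜]

theorem EllOne.norm_le_of_norm_apply_le_geometric {x : EllOne 𝕜} {C r : ℝ} (hr₀ : 0 ≤ r)
    (hr : r < 1) (hx : ∀ n, ‖x n‖ ≤ C * r ^ n) : ‖x‖ ≤ C * (1 - r)⁻¹ := by
  rw [EllOne.norm_eq, ← tsum_geometric_of_lt_one hr₀ hr, ← tsum_mul_left]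
  exact (EllOne.summable_norm x).tsum_le_tsum hx
    ((summable_geometric_of_lt_one hr₀ hr).mul_left C)

/-- The backward shift on `ℓ₁` with weights `1 / n`. -/
noncomputable abbrev harmonicShift (𝕜 : Type*) [RCLike 𝕜] : EllOne 𝕜 →L[𝕜] EllOne 𝕜 :=
  backwardShift (fun n : ℕ => 1 / (n : 𝕜)) (one_div_weights_bounded 𝕜)

/-- The backward shift on `ℓ₁` with all weights equal to `1`. -/
noncomputable abbrev unweightedShift (𝕜 : Type*) [RCLike 𝕜] : EllOne 𝕜 →L[𝕜] EllOne 𝕜 :=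
  backwardShift (fun _ => (1 : 𝕜)) ⟨1, fun _ _ => norm_one.le⟩

theorem lie_harmonicShift_unweightedShift :
    ⁅harmonicShift 𝕜, unweightedShift 𝕜⁆ = harmonicShift 𝕜 ^ 2 := by
  ext x n
  change 1 / ((n + 1 : ℕ) : 𝕜) * (1 * x (n + 2)) - 1 * (1 / ((n + 2 : ℕ) : 𝕜) * x (n + 2)) =
    1 / ((n + 1 : ℕ) : 𝕜) * (1 / ((n + 2 : ℕ) : 𝕜) * x (n + 2))
  have hn₁ : ((n + 1 : ℕ) : 𝕜) ≠ 0 := Nat.cast_ne_zero.2 n.succ_ne_zero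
  have hn₂ : ((n + 2 : ℕ) : 𝕜) ≠ 0 := Nat.cast_ne_zero.2 (n + 1).succ_ne_zero
  field_simp
  push_cast
  ring

/-- The vector of `ℓ₁` with entries `s ^ n / (n + 1)`, for `‖s‖ < 1`. It is written as a series in
the canonical basis, which makes it analytic in `s`; if the series diverges, its value is `0`. -/
noncomputable def harmonicGeometric (s : 𝕜) : EllOne 𝕜 :=
  ∑' n : ℕ, s ^ n • ((n : 𝕜) + 1)⁻¹ • lp.single 1 n (1 : 𝕜)

theorem hasSum_harmonicGeometric {s : 𝕜} (hs : ‖s‖ < 1) :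
    HasSum (fun n : ℕ => s ^ n • ((n : 𝕜) + 1)⁻¹ • lp.single 1 n (1 : 𝕜))
      (harmonicGeometric s) := by
  refine (Summable.of_norm_bounded (summable_geometric_of_lt_one (norm_nonneg s) hs)
    fun n => ?_).hasSum
  have hn : ‖((n : 𝕜) + 1)⁻¹‖ ≤ 1 := by
    rw [norm_inv, ← Nat.cast_succ, RCLike.norm_natCast]
    exact inv_le_one_of_one_le₀ (by exact_mod_cast n.succ_pos)
  rw [norm_smul, norm_smul, lp.norm_single one_pos, norm_one, mul_one, norm_pow]
  exact mul_le_of_le_one_right (by positivity) hn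

theorem harmonicGeometric_apply {s : 𝕜} (hs : ‖s‖ < 1) (n : ℕ) :
    harmonicGeometric s n = s ^ n * ((n : 𝕜) + 1)⁻¹ := by
  refine ((hasSum_harmonicGeometric hs).mapL (lp.evalCLM 𝕜 (fun _ : ℕ => 𝕜) 1 n)).unique ?_
  convert! hasSum_ite_eq n (s ^ n * ((n : 𝕜) + 1)⁻¹) using 2 with m
  change s ^ m * (((m : 𝕜) + 1)⁻¹ * (lp.single 1 m (1 : 𝕜) : EllOne 𝕜) n) = _
  split_ifs with hmn
  · rw [hmn, lp.single_apply_self, mul_one]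
  · rw [lp.single_apply_ne _ _ _ (Ne.symm hmn), mul_zero, mul_zero]

theorem one_sub_smul_harmonicShift_pow_harmonicGeometric_apply (lam : 𝕜) {s : 𝕜} (hs : ‖s‖ < 1)
    (k n : ℕ) :
    ((1 - lam • harmonicShift 𝕜) ^ k) (harmonicGeometric s) n =
      n.factorial * s ^ n * (scaledLaguerre 𝕜 k (n + 1)).eval (lam * s) := by
  induction k generalizing n with
  | zero =>
    rw [scaledLaguerre_zero, Polynomial.eval_C, Nat.factorial_succ, pow_zero]
    change harmonicGeometric s n = _
    rw [harmonicGeometric_apply hs]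
    have hn : (n.factorial : 𝕜) ≠ 0 := Nat.cast_ne_zero.2 n.factorial_ne_zero
    push_cast
    field_simp
  | succ k ih =>
    have hn : (n : 𝕜) + 1 ≠ 0 := Nat.cast_add_one_ne_zero n
    set y := ((1 - lam • harmonicShift 𝕜) ^ k) (harmonicGeometric s)
    calc ((1 - lam • harmonicShift 𝕜) ^ (k + 1)) (harmonicGeometric s) n
        = y n - lam * (1 / ((n + 1 : ℕ) : 𝕜) * y (n + 1)) := by rw [pow_succ']; rfl
      _ = n.factorial * s ^ n * (scaledLaguerre 𝕜 (k + 1) (n + 1)).eval (lam * s) := by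
        rw [ih, ih, scaledLaguerre_succ, Polynomial.eval_sub, Polynomial.eval_mul,
          Polynomial.eval_X, Nat.factorial_succ, pow_succ]
        push_cast
        field_simp

theorem norm_one_sub_smul_harmonicShift_pow_harmonicGeometric_le {lam s : 𝕜} {u : ℝ} (hu : 0 < u)
    (hs : ‖s‖ < 1) (hlam : lam * s = u) (k : ℕ) :
    ‖((1 - lam • harmonicShift 𝕜) ^ k) (harmonicGeometric s)‖ ≤
      Real.exp u / √((k + 1) * u) * (1 - ‖s‖)⁻¹ := by
  refine EllOne.norm_le_of_norm_apply_le_geometric (norm_nonneg s) hs fun n => ?_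
  rw [one_sub_smul_harmonicShift_pow_harmonicGeometric_apply lam hs, hlam, norm_mul, norm_mul,
    norm_pow, RCLike.norm_natCast]
  calc _ ≤ n.factorial * ‖s‖ ^ n *
        ((n.factorial : ℝ)⁻¹ * (Real.exp u / √((k + 1) * u))) := by
        gcongr
        exact norm_eval_ofReal_scaledLaguerre_succ_le k n hu
    _ = Real.exp u / √((k + 1) * u) * ‖s‖ ^ n := by field_simp

theorem harmonicGeometric_mem_vanishingOrbits {lam s : 𝕜} {u : ℝ} (hu : 0 < u) (hs : ‖s‖ < 1)
    (hlam : lam * s = u) : harmonicGeometric s ∈ vanishingOrbits (1 - lam • harmonicShift 𝕜) := by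
  refine squeeze_zero_norm
    (norm_one_sub_smul_harmonicShift_pow_harmonicGeometric_le hu hs hlam) ?_
  have hsqrt : Tendsto (fun k : ℕ => √(((k : ℝ) + 1) * u)) atTop atTop :=
    Real.tendsto_sqrt_atTop.comp <|
      (tendsto_atTop_add_const_right _ 1 tendsto_natCast_atTop_atTop).atTop_mul_const hu
  simpa only [zero_mul] using (hsqrt.const_div_atTop (Real.exp u)).mul_const (1 - ‖s‖)⁻¹

theorem frequently_harmonicGeometric_mem_vanishingOrbits {lam : 𝕜} (hlam : lam ≠ 0) :
    ∃ᶠ s in 𝓝[≠] 0, harmonicGeometric s ∈ vanishingOrbits (1 - lam • harmonicShift 𝕜) := by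
  have htendsto : Tendsto (fun u : ℝ => (u : 𝕜) / lam) (𝓝[>] 0) (𝓝[≠] 0) := by
    refine tendsto_nhdsWithin_iff.2 ⟨?_, ?_⟩
    · refine Tendsto.mono_left ?_ nhdsWithin_le_nhds
      simpa using (RCLike.continuous_ofReal.tendsto (0 : ℝ)).div_const lam
    · filter_upwards [self_mem_nhdsWithin] with u hu
      exact div_ne_zero (RCLike.ofReal_ne_zero.2 (ne_of_gt hu)) hlam
  refine htendsto.frequently (Eventually.frequently ?_)
  filter_upwards [Ioo_mem_nhdsGT (norm_pos_iff.2 hlam)] with u ⟨hu₀, hu⟩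
  refine harmonicGeometric_mem_vanishingOrbits hu₀ ?_ (mul_div_cancel₀ _ hlam)
  rwa [norm_div, RCLike.norm_ofReal, abs_of_pos hu₀, div_lt_one (norm_pos_iff.2 hlam)]

theorem dense_vanishingOrbits_one_sub_smul_harmonicShift {lam : 𝕜} (hlam : lam ≠ 0) :
    Dense (vanishingOrbits (1 - lam • harmonicShift 𝕜) : Set (EllOne 𝕜)) := by
  let G := (vanishingOrbits (1 - lam • harmonicShift 𝕜)).topologicalClosure
  have hG : IsClosed (G : Set (EllOne 𝕜)) := Submodule.isClosed_topologicalClosure _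
  have hseries : ∀ᶠ s : 𝕜 in 𝓝 0,
      HasSum (fun n : ℕ => s ^ n • ((n : 𝕜) + 1)⁻¹ • lp.single 1 n (1 : 𝕜))
        (harmonicGeometric s) :=
    (eventually_norm_sub_lt 0 one_pos).mono fun s hs =>
      hasSum_harmonicGeometric (by simpa only [sub_zero] using hs)
  have hmem : ∃ᶠ s in 𝓝[≠] (0 : 𝕜), harmonicGeometric s ∈ G :=
    (frequently_harmonicGeometric_mem_vanishingOrbits hlam).mono fun s hs =>
      Submodule.le_topologicalClosure _ hs
  refine Submodule.dense_iff_topologicalClosure_eq_top.2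
    (lp_eq_top_of_isClosed_of_single_mem ENNReal.one_ne_top hG fun n => ?_)
  exact (G.smul_mem_iff (inv_ne_zero (Nat.cast_add_one_ne_zero n))).1
    (mem_of_hasSum_of_frequently_mem hG hseries hmem n)

end HarmonicShift

theorem mainTheorem6 {𝕜 : Type*} [RCLike 𝕜] (lam : 𝕜) (hlam : lam ≠ 0) :
    SatisfiesKitaiCriterion
      (ContinuousLinearMap.id 𝕜 (EllOne 𝕜) +
        lam • backwardShift (fun n : ℕ => 1 / (n : 𝕜)) (one_div_weights_bounded 𝕜)) := by
  have hlie : ⁅lam • harmonicShift 𝕜, lam • unweightedShift 𝕜⁆ = (lam • harmonicShift 𝕜) ^ 2 := by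
    rw [Ring.lie_def, smul_mul_smul_comm, smul_mul_smul_comm, ← smul_sub, ← Ring.lie_def,
      lie_harmonicShift_unweightedShift, smul_pow, sq lam]
  have hsub := dense_vanishingOrbits_one_sub_smul_harmonicShift hlam
  have hadd : Dense (vanishingOrbits (1 + lam • harmonicShift 𝕜) : Set (EllOne 𝕜)) := by
    simpa only [neg_smul, sub_neg_eq_add] using
      dense_vanishingOrbits_one_sub_smul_harmonicShift (neg_ne_zero.2 hlam)
  exact .one_add_of_lie_eq_sq hlie hadd hsub
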